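/- Let $D_4$ be the lattice $L=\mathbb{Z}^4$ in $V=\mathbb{R}^4$ equipped with the symmetric bilinear form $B(x,y)=xGy^{T}$, where $$G=\begin{pmatrix}2&-1&0&0\\-1&2&-1&-1\\0&-1&2&0\\0&-1&0&2\end{pmatrix}.$$ Extend $B$ to $\mathbb{C}^4$ $\mathbb{C}$-bilinearly, put $Q(x)=\tfrac12B(x,x)$ and $\mathfrak{e}(x)=\exp(2\pi i x)$, and let $D_4^\sharp=\{x\in\mathbb{R}^4: B(x,v)\in\mathbb{Z}\text{ for all }v\in\mathbb{Z}^4\}$ be the dual lattice. Let $\mathbb{H}$ be the upper half plane. For $\alpha\in D_4^\sharp$ and $\beta\in\tfrac12\mathbb{Z}^4$ let $\theta_{\alpha,\beta}\colon\mathbb{H}\times\mathbb{C}^4\to\mathbb{C}$ be given by the series $$\theta_{\alpha,\beta}(\tau,z)=\sum_{v\in\mathbb{Z}^4}\mathfrak{e}(B(\beta,v))\,\mathfrak{e}\bigl(\tau Q(\alpha+v)+B(\alpha+v,z)\bigr),$$ which converges absolutely for all $(\tau,z)\in\mathbb{H}\times\mathbb{C}^4$. **Theorem.** The seven functions $\theta_{\alpha,0}^2$,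 $\theta_{0,\beta}^2$ on $\mathbb{H}\times\mathbb{C}^4$, where $\alpha$ ranges over the representatives $$(0,0,0,0),\quad(0,0,\tfrac12,\tfrac12),\quad(\tfrac12,0,0,\tfrac12),\quad(\tfrac12,0,\tfrac12,0)$$ of $D_4^\sharp/D_4$ and $\beta$ ranges over the representatives $$(0,0,0,0),\quad(\tfrac12,\tfrac12,\tfrac12,\tfrac12),\quad(\tfrac12,0,0,0),\quad(0,\tfrac12,0,0)$$ of $\tfrac12D_4/D_4^\sharp$ (the function $\theta_{0,0}^2$, which occurs for $\alpha=0$ and for $\beta=0$, being counted once), are linearly independent over $\mathbb{C}$. Moreover, for all $\alpha\in D_4^\sharp$ and all $\beta\in\tfrac12\mathbb{Z}^4$, $$\theta_{\alpha,\beta}^2+\theta_{0,0}^2=\theta_{\alpha,0}^2+\theta_{0,\beta}^2.$$ -/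

import Mathlib

/-- The bilinear form `B(x, y) = x G yᵀ` on row vectors over a commutative ring `R`,
for an integral Gram matrix `G`.  For `R = ℂ` it is the `ℂ`-bilinear extension of the form for
`R = ℝ`. -/
def latticeB {n : ℕ} (G : Matrix (Fin n) (Fin n) ℤ) {R : Type*} [CommRing R]
    (x y : Fin n → R) : R :=
  ∑ i, ∑ j, x i * (G i j : R) * y j

/-- The quadratic form `Q(x) = B(x, x) / 2`. -/
noncomputable def latticeQ {n : ℕ} (G : Matrix (Fin n) (Fin n) ℤ) {K : Type*} [Field K]
    (x : Fin n → K) : K :=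
  latticeB G x x / 2

/-- The dual lattice in `ℝⁿ` of the lattice `ℤⁿ` with Gram matrix `G`: the vectors `x` with
`B(x, v) ∈ ℤ` for all `v ∈ ℤⁿ`. -/
def dualLattice {n : ℕ} (G : Matrix (Fin n) (Fin n) ℤ) : Set (Fin n → ℝ) :=
  {x | ∀ v : Fin n → ℤ, ∃ m : ℤ, latticeB G x (fun i => (v i : ℝ)) = (m : ℝ)}

/-- The set `½ ℤⁿ` inside `ℝⁿ`. -/
def halfIntegral (n : ℕ) : Set (Fin n → ℝ) :=
  {x | ∃ v : Fin n → ℤ, ∀ i, x i = (v i : ℝ) / 2}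

/-- `𝔢(z) = exp(2πiz)`. -/
noncomputable def fourierE (z : ℂ) : ℂ :=
  Complex.exp (2 * (Real.pi : ℂ) * Complex.I * z)

/-- The term of index `v ∈ ℤⁿ` of the theta series:
`𝔢(B(β, v)) 𝔢(τ Q(α + v) + B(α + v, z))`. -/
noncomputable def thetaTerm {n : ℕ} (G : Matrix (Fin n) (Fin n) ℤ) (α β : Fin n → ℝ)
    (τ : UpperHalfPlane) (z : Fin n → ℂ) (v : Fin n → ℤ) : ℂ :=
  fourierE (latticeB G (fun i => (β i : ℂ)) (fun i => (v i : ℂ))) *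
    fourierE ((τ : ℂ) * latticeQ G (fun i => (α i : ℂ) + (v i : ℂ)) +
      latticeB G (fun i => (α i : ℂ) + (v i : ℂ)) z)

/-- The Jacobi theta series `θ_{α,β}` of the lattice `ℤⁿ` with Gram matrix `G`, a function on
`ℍ × ℂⁿ`. -/
noncomputable def thetaSeries {n : ℕ} (G : Matrix (Fin n) (Fin n) ℤ) (α β : Fin n → ℝ) :
    UpperHalfPlane × (Fin n → ℂ) → ℂ :=
  fun p => ∑' v : Fin n → ℤ, thetaTerm G α β p.1 p.2 v

/-- The Gram matrix of the root lattice `D₄` with respect to the standard basis of `ℤ⁴`. -/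
def gramD4 : Matrix (Fin 4) (Fin 4) ℤ :=
  !![ 2, -1,  0,  0;
     -1,  2, -1, -1;
      0, -1,  2,  0;
      0, -1,  0,  2]

/-- Representatives of the three nonzero classes of `D₄♯ / D₄`. -/
noncomputable def alphaD4 : Fin 3 → Fin 4 → ℝ :=
  ![![0, 0, 1 / 2, 1 / 2], ![1 / 2, 0, 0, 1 / 2], ![1 / 2, 0, 1 / 2, 0]]

/-- Representatives of the three nonzero classes of `½D₄ / D₄♯`. -/
noncomputable def betaD4 : Fin 3 → Fin 4 → ℝ :=
  ![![1 / 2, 1 / 2, 1 / 2, 1 / 2], ![1 / 2, 0, 0, 0], ![0, 1 / 2, 0, 0]]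

/-- The seven functions `θ_{0,0}²`, `θ_{α,0}²`, `θ_{0,β}²`, with `α`, `β` ranging over the
representatives of the nonzero classes. -/
noncomputable def sevenThetaSquares :
    Unit ⊕ Fin 3 ⊕ Fin 3 → (UpperHalfPlane × (Fin 4 → ℂ) → ℂ)
  | Sum.inl _ => thetaSeries gramD4 0 0 ^ 2
  | Sum.inr (Sum.inl i) => thetaSeries gramD4 (alphaD4 i) 0 ^ 2
  | Sum.inr (Sum.inr j) => thetaSeries gramD4 0 (betaD4 j) ^ 2

/-!
Write `L = ℤ⁴` for the lattice `D₄` and `L♯` for its dual. Multiplying two theta series with the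
same characteristics and changing variables from `(α + v, α + w)` to their sum and difference
gives the addition formula `thetaSeries_sq_of_inRadical`:

  `θ_{α,β}(τ, z)² = ∑_k χ_β(k) Θ_{k + 2α}(τ, 0) Θ_k(τ, z)`,  `k ∈ L / 2L`,

where `Θ_k(τ, z) = ∑_{d ≡ k} 𝔢(τ Q(d) / 2 + B(d, z))` (`thetaClass`) and
`χ_β(k) = (-1) ^ B(2β, k)` (`signChar`).

The sixteen classes of `L / 2L` are the four in the radical `2L♯ / 2L` of `B` modulo 2 and the
twelve classes of the roots. On the radical `χ_β` is trivial. The Weyl group permutes the root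
classes transitively, so `Θ_k(τ, 0)` is the same for all of them (`thetaClass_of_not_inRadical`),
and translation by `2α` does not change it. Hence for each `k` one of `α` and `β` has no influence
on the coefficient of `Θ_k(τ, z)`, which gives the quadratic relation.

For the linear independence, evaluation at suitable points `z ∈ ¼L` separates the classes `k`
(`coeff_mul_thetaClass_eq_zero`), so in a vanishing combination the coefficient of `Θ_k(τ, z)`
vanishes as soon as `Θ_k(τ, 0) ≠ 0`, as is the case at `τ = i`. On the radical, the shift
`τ ↦ τ + 1/2` fixes `Θ_0(τ, 0)` and negates the other `Θ_k(τ, 0)` (`thetaClass_half_vadd`); this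
isolates the coefficients of the `θ_{α,0}²`. The remaining coefficients satisfy a linear relation
between the four characters of `L / 2L♯`.
-/

/-! ### Coordinates for the Gram matrix -/

theorem latticeB_gramD4 {R : Type*} [CommRing R] (x y : Fin 4 → R) :
    latticeB gramD4 x y = 2 * x 0 * y 0 + 2 * x 1 * y 1 + 2 * x 2 * y 2 + 2 * x 3 * y 3
      - x 0 * y 1 - x 1 * y 0 - x 1 * y 2 - x 2 * y 1 - x 1 * y 3 - x 3 * y 1 := by
  simp [latticeB, gramD4, Fin.sum_univ_four]
  ring

theorem latticeQ_gramD4 {K : Type*} [Field K] [CharZero K] (x : Fin 4 → K) :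
    latticeQ gramD4 x = x 0 ^ 2 + x 1 ^ 2 + x 2 ^ 2 + x 3 ^ 2
      - x 0 * x 1 - x 1 * x 2 - x 1 * x 3 := by
  rw [latticeQ, latticeB_gramD4]
  field_simp
  ring

/-- The form is positive definite, with a diagonal lower bound. -/
theorem le_latticeQ_gramD4 (x : Fin 4 → ℝ) :
    ∑ i, x i ^ 2 / 10 ≤ latticeQ gramD4 x := by
  rw [latticeQ_gramD4, Fin.sum_univ_four]
  nlinarith [sq_nonneg (x 0 * 9 / 5 - x 1), sq_nonneg (x 2 * 9 / 5 - x 1),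
    sq_nonneg (x 3 * 9 / 5 - x 1), sq_nonneg (x 1), sq_nonneg (x 0), sq_nonneg (x 2),
    sq_nonneg (x 3)]

theorem fourierE_add (z w : ℂ) : fourierE (z + w) = fourierE z * fourierE w := by
  simp only [fourierE, mul_add, Complex.exp_add]

theorem fourierE_intCast (m : ℤ) : fourierE m = 1 := by
  rw [fourierE, Complex.exp_eq_one_iff]
  exact ⟨m, by ring⟩

theorem fourierE_one_half : fourierE (1 / 2) = -1 := by
  rw [fourierE, ← Complex.exp_pi_mul_I]
  congr 1
  ring

theorem fourierE_intCast_div_two (m : ℤ) :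
    fourierE ((m : ℂ) / 2) = if (m : ZMod 2) = 0 then 1 else -1 := by
  rcases Int.even_or_odd' m with ⟨n, rfl | rfl⟩
  · have h2 : ((2 : ℤ) : ZMod 2) = 0 := rfl
    have : ((2 * n : ℤ) : ℂ) / 2 = (n : ℤ) := by push_cast; ring
    rw [this, fourierE_intCast, Int.cast_mul, h2, zero_mul, if_pos rfl]
  · have h2 : ((2 : ℤ) : ZMod 2) = 0 := rfl
    have : ((2 * n + 1 : ℤ) : ℂ) / 2 = (n : ℤ) + 1 / 2 := by push_cast; ring
    rw [this, fourierE_add, fourierE_intCast, fourierE_one_half, Int.cast_add, Int.cast_mul, h2,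
      zero_mul, if_neg (by decide), one_mul]

theorem norm_fourierE (z : ℂ) : ‖fourierE z‖ = Real.exp (-(2 * Real.pi * z.im)) := by
  rw [fourierE, Complex.norm_exp]
  congr 1
  simp

/-! ### Absolute convergence -/

theorem summable_exp_neg_quadratic {c : ℝ} (hc : 0 < c) (d : ℝ) :
    Summable fun n : ℤ => Real.exp (-(c * n ^ 2 + d * n)) := by
  have h := ((summable_jacobiTheta₂_term_iff (((d / (2 * Real.pi) : ℝ) : ℂ) * Complex.I)
    (((c / Real.pi : ℝ) : ℂ) * Complex.I)).2 (by
      rw [Complex.im_ofReal_mul, Complex.I_im, mul_one]; positivity)).norm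
  refine h.congr fun n => ?_
  rw [norm_jacobiTheta₂_term, Complex.im_ofReal_mul, Complex.im_ofReal_mul]
  congr 1
  have := Real.pi_ne_zero
  simp
  field_simp
  ring

theorem summable_pi_prod_of_nonneg {β : Type*} :
    ∀ {n : ℕ} (f : Fin n → β → ℝ), (∀ i b, 0 ≤ f i b) → (∀ i, Summable (f i)) →
      Summable fun v : Fin n → β => ∏ i, f i (v i)
  | 0, _, _, _ => (hasSum_fintype _).summable
  | n + 1, f, hf, hs => by
    have ih := summable_pi_prod_of_nonneg (fun i : Fin n => f i.succ) (fun i => hf _)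
      fun i => hs _
    have h := (hs 0).mul_of_nonneg ih (hf 0) fun v => Finset.prod_nonneg fun i _ => hf _ _
    rw [← (Fin.consEquiv fun _ : Fin (n + 1) => β).summable_iff]
    refine h.congr fun p => ?_
    simp [Fin.prod_univ_succ, Fin.consEquiv]

/-- Each Gaussian term is dominated by a product of one-dimensional ones, by the diagonal lower
bound for the form. -/
theorem summable_norm_gaussian (α : Fin 4 → ℝ) {t : ℂ} (ht : 0 < t.im) (z : Fin 4 → ℂ) :
    Summable fun v : Fin 4 → ℤ => ‖fourierE (t * latticeQ gramD4 (fun i => (α i : ℂ) + (v i : ℂ)) +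
      latticeB gramD4 (fun i => (α i : ℂ) + (v i : ℂ)) z)‖ := by
  set c : Fin 4 → ℝ := fun i => ∑ j, (gramD4 i j : ℝ) * (z j).im with hc
  have hpi := Real.pi_pos
  have h := summable_pi_prod_of_nonneg
    (fun (i : Fin 4) (n : ℤ) => Real.exp (-(2 * Real.pi * (t.im / 10) * n ^ 2 +
      (2 * Real.pi * (t.im / 5 * α i + c i)) * n)) *
      Real.exp (-(2 * Real.pi * (t.im / 10 * α i ^ 2 + c i * α i))))
    (fun i n => by positivity)
    (fun i => (summable_exp_neg_quadratic (by positivity) _).mul_right _)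
  refine h.of_nonneg_of_le (fun v => norm_nonneg _) fun v => ?_
  simp_rw [← Real.exp_add]
  rw [← Real.exp_sum, norm_fourierE, Real.exp_le_exp]
  have hB : (latticeB gramD4 (fun i => (α i : ℂ) + (v i : ℂ)) z).im = ∑ i, (α i + v i) * c i := by
    rw [latticeB_gramD4]
    simp [hc, gramD4, Fin.sum_univ_four]
    ring
  have hQ : latticeQ gramD4 (fun i => (α i : ℂ) + (v i : ℂ)) =
      ((latticeQ gramD4 (fun i => α i + (v i : ℝ)) : ℝ) : ℂ) := by
    rw [latticeQ_gramD4, latticeQ_gramD4]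
    push_cast
    ring
  have hle := mul_le_mul_of_nonneg_left
    (mul_le_mul_of_nonneg_left (le_latticeQ_gramD4 fun i => α i + (v i : ℝ)) ht.le)
    (by positivity : 0 ≤ 2 * Real.pi)
  rw [Complex.add_im, hB, hQ, Complex.im_mul_ofReal]
  simp only [Fin.sum_univ_four] at hle ⊢
  linarith

theorem norm_thetaTerm {n : ℕ} (G : Matrix (Fin n) (Fin n) ℤ) (α β : Fin n → ℝ)
    (τ : UpperHalfPlane) (z : Fin n → ℂ) (v : Fin n → ℤ) :
    ‖thetaTerm G α β τ z v‖ = ‖fourierE ((τ : ℂ) * latticeQ G (fun i => (α i : ℂ) + (v i : ℂ)) +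
      latticeB G (fun i => (α i : ℂ) + (v i : ℂ)) z)‖ := by
  have h : (latticeB G (fun i => (β i : ℂ)) (fun i => (v i : ℂ))) =
      ((latticeB G β (fun i => (v i : ℝ)) : ℝ) : ℂ) := by
    simp [latticeB]
  rw [thetaTerm, norm_mul, norm_fourierE, h, Complex.ofReal_im]
  simp

theorem summable_norm_thetaTerm_gramD4 (α β : Fin 4 → ℝ) (τ : UpperHalfPlane) (z : Fin 4 → ℂ) :
    Summable fun v => ‖thetaTerm gramD4 α β τ z v‖ := by
  simp_rw [norm_thetaTerm]
  exact summable_norm_gaussian α τ.im_pos z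

/-! ### The addition formula -/

/-- The class of a lattice vector in `L / 2L = (ℤ/2)⁴`. -/
def residue (d : Fin 4 → ℤ) : Fin 4 → ZMod 2 := fun i => (d i : ZMod 2)

/-- `𝔢(τ Q(d) / 2 + B(d, z))`: the theta term of `d` on the lattice with form `B / 2`,
in the variable `2z`. -/
noncomputable def gaussian (τ : UpperHalfPlane) (z : Fin 4 → ℂ) (d : Fin 4 → ℤ) : ℂ :=
  fourierE ((τ : ℂ) * latticeQ gramD4 (fun i => (d i : ℂ)) / 2 +
    latticeB gramD4 (fun i => (d i : ℂ)) z)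

/-- The part of `gaussian τ z` supported on the class `k` modulo `2L`. -/
noncomputable def classGaussian (k : Fin 4 → ZMod 2) (τ : UpperHalfPlane) (z : Fin 4 → ℂ)
    (d : Fin 4 → ℤ) : ℂ :=
  if residue d = k then gaussian τ z d else 0

/-- The theta series `Θ_k(τ, z) = ∑ 𝔢(τ Q(d) / 2 + B(d, z))` over the `d ∈ L` in the class `k`
modulo `2L`. -/
noncomputable def thetaClass (k : Fin 4 → ZMod 2) (τ : UpperHalfPlane) (z : Fin 4 → ℂ) : ℂ :=
  ∑' d, classGaussian k τ z d

/-- The character `(-1) ^ B(b, k)` of `L / 2L`, for `b ∈ L / 2L`. -/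
noncomputable def signChar (b k : Fin 4 → ZMod 2) : ℂ :=
  if latticeB gramD4 b k = 0 then 1 else -1

theorem summable_norm_classGaussian (k : Fin 4 → ZMod 2) (τ : UpperHalfPlane) (z : Fin 4 → ℂ) :
    Summable fun d => ‖classGaussian k τ z d‖ := by
  have ht : 0 < ((τ : ℂ) / 2).im := by
    have := τ.im_pos
    rw [Complex.div_ofNat_im]
    exact half_pos this
  refine (summable_norm_gaussian 0 ht z).of_nonneg_of_le (fun d => norm_nonneg _) fun d => ?_
  rw [classGaussian]
  split_ifs
  · refine le_of_eq ?_
    simp [gaussian, div_mul_eq_mul_div]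
  · simp

theorem residue_zero : residue 0 = 0 := by
  funext i
  simp [residue]

theorem signChar_zero (k : Fin 4 → ZMod 2) : signChar 0 k = 1 := by
  simp [signChar, latticeB]

theorem fourierE_latticeB_half (b v : Fin 4 → ℤ) {β : Fin 4 → ℝ} (hβ : ∀ i, β i = b i / 2) :
    fourierE (latticeB gramD4 (fun i => (β i : ℂ)) (fun i => (v i : ℂ))) =
      signChar (residue b) (residue v) := by
  have h : latticeB gramD4 (fun i => (β i : ℂ)) (fun i => (v i : ℂ)) =
      ((latticeB gramD4 b v : ℤ) : ℂ) / 2 := by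
    simp only [latticeB_gramD4, hβ]
    push_cast
    ring
  have h' : ((latticeB gramD4 b v : ℤ) : ZMod 2) = latticeB gramD4 (residue b) (residue v) := by
    simp [latticeB, residue]
  rw [h, fourierE_intCast_div_two, h', signChar]

/-- The change of variables `(α + v, α + w) ↦ (2α + v + w, v - w)`, under which
`Q(α + v) + Q(α + w)` becomes half the sum of the two values of `Q`. -/
theorem thetaTerm_mul_thetaTerm (a b : Fin 4 → ℤ) {α β : Fin 4 → ℝ} (hα : ∀ i, α i = a i / 2)
    (hβ : ∀ i, β i = b i / 2) (τ : UpperHalfPlane) (z : Fin 4 → ℂ) (v w : Fin 4 → ℤ) :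
    thetaTerm gramD4 α β τ z v * thetaTerm gramD4 α β τ z w =
      signChar (residue b) (residue (v - w)) *
        (gaussian τ z (v + w + a) * gaussian τ 0 (v - w)) := by
  have hres : residue (v - w) = residue (v + w) := by
    funext i
    simp [residue, sub_eq_add_neg, ZMod.neg_eq_self_mod_two]
  rw [hres, ← fourierE_latticeB_half b (v + w) hβ]
  simp only [thetaTerm, gaussian, ← fourierE_add]
  congr 1
  simp only [latticeB_gramD4, latticeQ_gramD4, hα, Pi.add_apply, Pi.sub_apply, Pi.zero_apply]
  push_cast
  ring

theorem injective_add_add_sub (a : Fin 4 → ℤ) : Function.Injective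
    fun p : (Fin 4 → ℤ) × (Fin 4 → ℤ) => (p.1 + p.2 + a, p.1 - p.2) := by
  rintro ⟨v, w⟩ ⟨v', w'⟩ h
  simp only [Prod.mk.injEq] at h ⊢
  constructor <;> funext i <;>
    · have h1 := congrFun h.1 i
      have h2 := congrFun h.2 i
      simp only [Pi.add_apply, Pi.sub_apply] at h1 h2
      omega

/-- The pairs `(u, d)` with `u ≡ d + a` modulo `2L` are those reached by the change of
variables. -/
theorem mem_range_add_add_sub {a u d : Fin 4 → ℤ} (h : residue u = residue d + residue a) :
    (u, d) ∈ Set.range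
      fun p : (Fin 4 → ℤ) × (Fin 4 → ℤ) => (p.1 + p.2 + a, p.1 - p.2) := by
  have h2 (i : Fin 4) : (2 : ℤ) ∣ u i - a i - d i := by
    have := congrFun h i
    simp only [residue, Pi.add_apply] at this
    have h0 : ((u i - a i - d i : ℤ) : ZMod 2) = 0 := by
      push_cast
      rw [this]
      ring
    exact (ZMod.intCast_zmod_eq_zero_iff_dvd _ 2).1 h0
  choose w hw using h2
  refine ⟨(w + d, w), ?_⟩
  simp only [Prod.mk.injEq]
  constructor <;> funext i <;> simp only [Pi.add_apply, Pi.sub_apply]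
  · have := hw i
    omega
  · omega

/-- The addition formula: the square of a theta function in terms of the sixteen functions
`Θ_k`. -/
theorem thetaSeries_sq (a b : Fin 4 → ℤ) {α β : Fin 4 → ℝ} (hα : ∀ i, α i = a i / 2)
    (hβ : ∀ i, β i = b i / 2) (τ : UpperHalfPlane) (z : Fin 4 → ℂ) :
    thetaSeries gramD4 α β (τ, z) ^ 2 = ∑ k, signChar (residue b) k *
      (thetaClass (k + residue a) τ z * thetaClass k τ 0) := by
  set F : (Fin 4 → ℤ) × (Fin 4 → ℤ) → ℂ := fun p =>
    ∑ k, signChar (residue b) k *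
      (classGaussian (k + residue a) τ z p.1 * classGaussian k τ 0 p.2) with hF
  have hF' (u d : Fin 4 → ℤ) : F (u, d) = if residue u = residue d + residue a then
      signChar (residue b) (residue d) * (gaussian τ z u * gaussian τ 0 d) else 0 := by
    simp only [hF]
    rw [Finset.sum_eq_single (residue d)]
    · simp [classGaussian]
    · intro k _ hk
      simp [classGaussian, hk.symm]
    · simp
  calc thetaSeries gramD4 α β (τ, z) ^ 2
      = ∑' p : (Fin 4 → ℤ) × (Fin 4 → ℤ),
          thetaTerm gramD4 α β τ z p.1 * thetaTerm gramD4 α β τ z p.2 := by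
        have h := summable_norm_thetaTerm_gramD4 α β τ z
        rw [sq, thetaSeries, tsum_mul_tsum_of_summable_norm h h]
    _ = ∑' p : (Fin 4 → ℤ) × (Fin 4 → ℤ), F (p.1 + p.2 + a, p.1 - p.2) := by
        refine tsum_congr fun p => ?_
        have hres : residue (p.1 + p.2 + a) = residue (p.1 - p.2) + residue a := by
          funext i
          simp [residue, sub_eq_add_neg, ZMod.neg_eq_self_mod_two]
        rw [thetaTerm_mul_thetaTerm a b hα hβ, hF', if_pos hres]
    _ = ∑' p, F p := by
        refine (injective_add_add_sub a).tsum_eq fun p hp => ?_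
        refine mem_range_add_add_sub (of_not_not fun h => hp ?_)
        rw [← Prod.mk.eta (p := p), hF', if_neg h]
    _ = _ := by
        rw [Summable.tsum_finsetSum fun k _ => (summable_mul_of_summable_norm
          (summable_norm_classGaussian _ τ z) (summable_norm_classGaussian k τ 0)).mul_left _]
        refine Finset.sum_congr rfl fun k _ => ?_
        rw [tsum_mul_left, ← tsum_mul_tsum_of_summable_norm
          (summable_norm_classGaussian _ τ z) (summable_norm_classGaussian k τ 0)]
        rfl

/-! ### Invariance under the Weyl group -/

/-- The reflection `x ↦ x - B(x, e_i) e_i` in the simple root `e_i`, over any commutative ring. -/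
def simpleReflection {R : Type*} [CommRing R] (i : Fin 4) (x : Fin 4 → R) : Fin 4 → R :=
  fun j => if j = i then x i - ∑ l, (gramD4 i l : R) * x l else x j

theorem residue_simpleReflection (i : Fin 4) (d : Fin 4 → ℤ) :
    residue (simpleReflection i d) = simpleReflection i (residue d) := by
  funext j
  simp only [residue, simpleReflection]
  split_ifs <;> simp

theorem simpleReflection_simpleReflection {R : Type*} [CommRing R] (i : Fin 4) (x : Fin 4 → R) :
    simpleReflection i (simpleReflection i x) = x := by
  funext j
  fin_cases i <;> fin_cases j <;> simp [simpleReflection, gramD4, Fin.sum_univ_four] <;> ring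

theorem latticeQ_simpleReflection {K : Type*} [Field K] [CharZero K] (i : Fin 4) (x : Fin 4 → K) :
    latticeQ gramD4 (simpleReflection i x) = latticeQ gramD4 x := by
  rw [latticeQ_gramD4, latticeQ_gramD4]
  fin_cases i <;> simp [simpleReflection, gramD4, Fin.sum_univ_four] <;> ring

theorem gaussian_simpleReflection (i : Fin 4) (τ : UpperHalfPlane) (d : Fin 4 → ℤ) :
    gaussian τ 0 (simpleReflection i d) = gaussian τ 0 d := by
  have h : (fun j => ((simpleReflection i d j : ℤ) : ℂ)) =
      simpleReflection i fun j => (d j : ℂ) := by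
    funext j
    simp only [simpleReflection]
    split_ifs <;> simp
  rw [gaussian, gaussian, h, latticeQ_simpleReflection]
  simp [latticeB]

theorem thetaClass_simpleReflection (i : Fin 4) (k : Fin 4 → ZMod 2) (τ : UpperHalfPlane) :
    thetaClass (simpleReflection i k) τ 0 = thetaClass k τ 0 := by
  have hinv : Function.Involutive (simpleReflection i : (Fin 4 → ℤ) → Fin 4 → ℤ) :=
    simpleReflection_simpleReflection i
  rw [thetaClass, ← (hinv.toPerm _).tsum_eq, thetaClass]
  refine tsum_congr fun d => ?_
  have hiff : simpleReflection i (residue d) = simpleReflection i k ↔ residue d = k :=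
    ⟨fun h => by
      rw [← simpleReflection_simpleReflection i (residue d), h,
        simpleReflection_simpleReflection], fun h => by rw [h]⟩
  simp only [Function.Involutive.coe_toPerm, classGaussian, residue_simpleReflection,
    gaussian_simpleReflection, hiff]

/-- The radical of `B` modulo 2, which is the image of `2L♯` in `L / 2L`. -/
def InRadical (k : Fin 4 → ZMod 2) : Prop := k 1 = 0 ∧ k 0 + k 2 + k 3 = 0

instance (k : Fin 4 → ZMod 2) : Decidable (InRadical k) :=
  inferInstanceAs (Decidable (_ ∧ _))

set_option maxRecDepth 100000 in
/-- The twelve classes outside the radical are those of the roots, and the Weyl group permutes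
the roots transitively. -/
theorem exists_simpleReflections_eq : ∀ k : Fin 4 → ZMod 2, ¬ InRadical k →
    ∃ i₁ i₂ i₃ i₄ : Fin 4, simpleReflection i₁ (simpleReflection i₂
      (simpleReflection i₃ (simpleReflection i₄ k))) = ![0, 1, 0, 0] := by
  decide

theorem thetaClass_of_not_inRadical {k : Fin 4 → ZMod 2} (hk : ¬ InRadical k)
    (τ : UpperHalfPlane) : thetaClass k τ 0 = thetaClass ![0, 1, 0, 0] τ 0 := by
  obtain ⟨i₁, i₂, i₃, i₄, h⟩ := exists_simpleReflections_eq k hk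
  rw [← h]
  simp only [thetaClass_simpleReflection]

/-! ### The quadratic relation -/

theorem InRadical.add_iff {a : Fin 4 → ZMod 2} (ha : InRadical a) (k : Fin 4 → ZMod 2) :
    InRadical (k + a) ↔ InRadical k := by
  obtain ⟨h1, h2⟩ := ha
  have : k 0 + a 0 + (k 2 + a 2) + (k 3 + a 3) = k 0 + k 2 + k 3 := by
    linear_combination h2
  simp only [InRadical, Pi.add_apply, h1, add_zero, this]

theorem latticeB_add_of_inRadical (b k : Fin 4 → ZMod 2) {a : Fin 4 → ZMod 2}
    (ha : InRadical a) : latticeB gramD4 b (k + a) = latticeB gramD4 b k := by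
  obtain ⟨h1, h2⟩ := ha
  have h : (2 : ZMod 2) = 0 := rfl
  simp only [latticeB_gramD4, Pi.add_apply]
  linear_combination (b 0 * a 0 + b 1 * a 1 + b 2 * a 2 + b 3 * a 3) * h
    - (b 0 + b 2 + b 3) * h1 - b 1 * h2

theorem signChar_add_of_inRadical (b k : Fin 4 → ZMod 2) {a : Fin 4 → ZMod 2}
    (ha : InRadical a) : signChar b (k + a) = signChar b k := by
  rw [signChar, latticeB_add_of_inRadical b k ha, signChar]

theorem signChar_of_inRadical (b : Fin 4 → ZMod 2) {k : Fin 4 → ZMod 2} (hk : InRadical k) :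
    signChar b k = 1 := by
  rw [← zero_add k, signChar_add_of_inRadical b 0 hk]
  simp [signChar, latticeB]

/-- The addition formula for `α ∈ L♯`, arranged by the functions `Θ_k(τ, z)`. -/
theorem thetaSeries_sq_of_inRadical {a : Fin 4 → ℤ} (ha : InRadical (residue a)) (b : Fin 4 → ℤ)
    {α β : Fin 4 → ℝ} (hα : ∀ i, α i = a i / 2) (hβ : ∀ i, β i = b i / 2) (τ : UpperHalfPlane)
    (z : Fin 4 → ℂ) :
    thetaSeries gramD4 α β (τ, z) ^ 2 = ∑ k, signChar (residue b) k *
      thetaClass (k + residue a) τ 0 * thetaClass k τ z := by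
  rw [thetaSeries_sq a b hα hβ, ← Equiv.sum_comp (Equiv.addRight (residue a))]
  have h2 (k : Fin 4 → ZMod 2) : k + residue a + residue a = k := by
    rw [add_assoc, CharTwo.add_self_eq_zero, add_zero]
  refine Finset.sum_congr rfl fun k _ => ?_
  rw [Equiv.coe_addRight, h2, signChar_add_of_inRadical _ _ ha]
  ring

theorem thetaSeries_sq_add_thetaSeries_sq {a : Fin 4 → ℤ} (ha : InRadical (residue a))
    (b : Fin 4 → ℤ) {α β : Fin 4 → ℝ} (hα : ∀ i, α i = a i / 2) (hβ : ∀ i, β i = b i / 2) :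
    thetaSeries gramD4 α β ^ 2 + thetaSeries gramD4 0 0 ^ 2 =
      thetaSeries gramD4 α 0 ^ 2 + thetaSeries gramD4 0 β ^ 2 := by
  funext ⟨τ, z⟩
  have h0 : InRadical (residue 0) := by
    rw [residue_zero]
    decide
  have hz : ∀ i, (0 : Fin 4 → ℝ) i = ((0 : Fin 4 → ℤ) i : ℝ) / 2 := by simp
  simp only [Pi.add_apply, Pi.pow_apply]
  rw [thetaSeries_sq_of_inRadical ha b hα hβ, thetaSeries_sq_of_inRadical h0 0 hz hz,
    thetaSeries_sq_of_inRadical ha 0 hα hz, thetaSeries_sq_of_inRadical h0 b hz hβ,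
    ← Finset.sum_add_distrib, ← Finset.sum_add_distrib]
  refine Finset.sum_congr rfl fun k _ => ?_
  rw [residue_zero, signChar_zero, add_zero]
  by_cases hk : InRadical k
  · rw [signChar_of_inRadical _ hk]
  · rw [thetaClass_of_not_inRadical hk, thetaClass_of_not_inRadical (mt (ha.add_iff k).1 hk)]
    ring

theorem exists_eq_half_of_mem_dualLattice {α : Fin 4 → ℝ} (hα : α ∈ dualLattice gramD4) :
    ∃ a : Fin 4 → ℤ, InRadical (residue a) ∧ ∀ i, α i = a i / 2 := by
  choose m hm using fun i : Fin 4 => hα (Pi.single i 1)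
  have h0 := hm 0
  have h1 := hm 1
  have h2 := hm 2
  have h3 := hm 3
  simp [latticeB_gramD4] at h0 h1 h2 h3
  -- The rows are those of the inverse Gram matrix, doubled.
  refine ⟨![2 * m 0 + 2 * m 1 + m 2 + m 3, 2 * m 0 + 4 * m 1 + 2 * m 2 + 2 * m 3,
    m 0 + 2 * m 1 + 2 * m 2 + m 3, m 0 + 2 * m 1 + m 2 + 2 * m 3], ?_, fun i => ?_⟩
  · have h : (2 : ZMod 2) = 0 := rfl
    have h4 : (4 : ZMod 2) = 0 := rfl
    constructor
    · simp [residue, h, h4]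
    · simp only [residue, Matrix.cons_val]
      push_cast
      linear_combination (2 * m 0 + 3 * m 1 + 2 * m 2 + 2 * m 3 : ZMod 2) * h
  · fin_cases i <;> simp <;> linarith

/-! ### Separating the functions `Θ_k` -/

/-- The character `(-1) ^ (m · k)` of `(ℤ/2)⁴`. -/
def dotSign (m k : Fin 4 → ZMod 2) : ℤ := if ∑ i, m i * k i = 0 then 1 else -1

/-- The vector `z ∈ ¼L` with `B(d, z) = (m · d) / 2` for all `d ∈ L`. -/
noncomputable def quarterPoint (m : Fin 4 → ℤ) : Fin 4 → ℂ :=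
  ![(2 * m 0 + 2 * m 1 + m 2 + m 3) / 4, (2 * m 0 + 4 * m 1 + 2 * m 2 + 2 * m 3) / 4,
    (m 0 + 2 * m 1 + 2 * m 2 + m 3) / 4, (m 0 + 2 * m 1 + m 2 + 2 * m 3) / 4]

theorem gaussian_quarterPoint (τ : UpperHalfPlane) (m d : Fin 4 → ℤ) :
    gaussian τ (quarterPoint m) d = dotSign (residue m) (residue d) * gaussian τ 0 d := by
  have h : latticeB gramD4 (fun i => (d i : ℂ)) (quarterPoint m) =
      ((∑ i, m i * d i : ℤ) : ℂ) / 2 := by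
    simp [latticeB_gramD4, quarterPoint, Fin.sum_univ_four]
    ring
  have h0 : latticeB gramD4 (fun i => (d i : ℂ)) 0 = 0 := by
    simp [latticeB]
  have hc : ((∑ i, m i * d i : ℤ) : ZMod 2) = ∑ i, residue m i * residue d i := by
    simp [residue]
  rw [gaussian, gaussian, fourierE_add, h, h0, add_zero, fourierE_intCast_div_two, mul_comm, hc,
    dotSign, Int.cast_ite, Int.cast_neg, Int.cast_one]

theorem thetaClass_quarterPoint (k : Fin 4 → ZMod 2) (τ : UpperHalfPlane) (m : Fin 4 → ℤ) :
    thetaClass k τ (quarterPoint m) = dotSign (residue m) k * thetaClass k τ 0 := by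
  rw [thetaClass, thetaClass, ← tsum_mul_left]
  refine tsum_congr fun d => ?_
  simp only [classGaussian]
  split_ifs with h
  · rw [gaussian_quarterPoint, h]
  · rw [mul_zero]

theorem exists_residue_eq (k : Fin 4 → ZMod 2) : ∃ d, residue d = k :=
  ⟨fun i => (k i).val, by funext i; simp [residue]⟩

set_option maxRecDepth 100000 in
theorem sum_dotSign : ∀ k : Fin 4 → ZMod 2, ∑ m, dotSign m k = if k = 0 then 16 else 0 := by
  decide

theorem dotSign_mul_dotSign (m k l : Fin 4 → ZMod 2) :
    dotSign m k * dotSign m l = dotSign m (k + l) := by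
  have h : ∀ x y : ZMod 2, (if x = 0 then (1 : ℤ) else -1) * (if y = 0 then 1 else -1) =
      if x + y = 0 then 1 else -1 := by decide
  simp only [dotSign, h, Pi.add_apply, mul_add, Finset.sum_add_distrib]

theorem sum_dotSign_mul_dotSign (k l : Fin 4 → ZMod 2) :
    ∑ m, dotSign m k * dotSign m l = if k = l then 16 else 0 := by
  simp_rw [dotSign_mul_dotSign, sum_dotSign]
  congr 1
  rw [← CharTwo.sub_eq_add, sub_eq_zero]

/-- At the points `quarterPoint m` the functions `Θ_k` are multiples of distinct characters of
`(ℤ/2)⁴`, so a linear relation between them is trivial wherever their values at `z = 0` do not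
vanish. -/
theorem coeff_mul_thetaClass_eq_zero {g : (Fin 4 → ZMod 2) → ℂ} {τ : UpperHalfPlane}
    (h : ∀ z, ∑ k, g k * thetaClass k τ z = 0) (k : Fin 4 → ZMod 2) :
    g k * thetaClass k τ 0 = 0 := by
  have h' (m : Fin 4 → ZMod 2) : ∑ l, (dotSign m l : ℂ) * (g l * thetaClass l τ 0) = 0 := by
    obtain ⟨d, rfl⟩ := exists_residue_eq m
    rw [← h (quarterPoint d)]
    refine Finset.sum_congr rfl fun l _ => ?_
    rw [thetaClass_quarterPoint]
    ring
  have h2 : ∑ m, (dotSign m k : ℂ) * ∑ l, (dotSign m l : ℂ) * (g l * thetaClass l τ 0) = 0 :=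
    Finset.sum_eq_zero fun m _ => by rw [h', mul_zero]
  simp_rw [Finset.mul_sum, ← mul_assoc] at h2
  rw [Finset.sum_comm] at h2
  have h3 (l : Fin 4 → ZMod 2) : ∑ m, (dotSign m k : ℂ) * dotSign m l * g l * thetaClass l τ 0 =
      if k = l then 16 * (g l * thetaClass l τ 0) else 0 := by
    rw [← Finset.sum_mul, ← Finset.sum_mul]
    have := congrArg (Int.cast : ℤ → ℂ) (sum_dotSign_mul_dotSign k l)
    push_cast at this
    rw [this]
    split_ifs <;> ring
  simpa [h3] using h2

/-! ### Values at `z = 0` -/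

theorem classGaussian_I_zero (k : Fin 4 → ZMod 2) (d : Fin 4 → ℤ) :
    classGaussian k UpperHalfPlane.I 0 d = (‖classGaussian k UpperHalfPlane.I 0 d‖ : ℝ) := by
  simp only [classGaussian]
  split_ifs
  · have h : gaussian UpperHalfPlane.I 0 d =
        (Real.exp (-(Real.pi * latticeQ gramD4 fun i => (d i : ℝ))) : ℝ) := by
      simp only [gaussian, fourierE, latticeQ_gramD4, latticeB_gramD4, Pi.zero_apply,
        UpperHalfPlane.coe_I]
      push_cast
      congr 1
      linear_combination (Real.pi : ℂ) * ((d 0 : ℂ) ^ 2 + d 1 ^ 2 + d 2 ^ 2 + d 3 ^ 2 - d 0 * d 1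
        - d 1 * d 2 - d 1 * d 3) * Complex.I_mul_I
    rw [h, Complex.norm_real, Real.norm_of_nonneg (Real.exp_nonneg _)]
  · simp

/-- At `τ = i` and `z = 0` all the terms are positive. -/
theorem thetaClass_I_zero_ne_zero (k : Fin 4 → ZMod 2) : thetaClass k UpperHalfPlane.I 0 ≠ 0 := by
  obtain ⟨d, rfl⟩ := exists_residue_eq k
  have hpos : 0 < ‖classGaussian (residue d) UpperHalfPlane.I 0 d‖ := by
    rw [classGaussian, if_pos rfl, gaussian, norm_fourierE]
    exact Real.exp_pos _
  rw [thetaClass, tsum_congr (classGaussian_I_zero _), ← Complex.ofReal_tsum]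
  exact Complex.ofReal_ne_zero.2
    ((summable_norm_classGaussian _ _ 0).tsum_pos (fun _ => norm_nonneg _) d hpos).ne'

/-- The sign by which `Θ_k(τ, 0)`, for `k` in the radical, changes under `τ ↦ τ + 1/2`. -/
noncomputable def shiftSign (k : Fin 4 → ZMod 2) : ℂ := if k = 0 then 1 else -1

/-- For `d` in the radical modulo 2, `Q(d)` is divisible by 2, and it is divisible by 4 exactly
when `d ∈ 2L`. -/
theorem fourierE_latticeQ_div_four {d : Fin 4 → ℤ} (hd : InRadical (residue d)) :
    fourierE (latticeQ gramD4 (fun i => (d i : ℂ)) / 4) = shiftSign (residue d) := by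
  obtain ⟨p, hp⟩ : (2 : ℤ) ∣ d 1 := (ZMod.intCast_zmod_eq_zero_iff_dvd _ 2).1 hd.1
  obtain ⟨r, hr⟩ : (2 : ℤ) ∣ d 0 + d 2 + d 3 :=
    (ZMod.intCast_zmod_eq_zero_iff_dvd _ 2).1 (by simpa [residue] using hd.2)
  have hQ : latticeQ gramD4 (fun i => (d i : ℂ)) / 4 =
      ((2 * (p ^ 2 - p * r + r ^ 2) - (d 0 * d 2 + d 0 * d 3 + d 2 * d 3) : ℤ) : ℂ) / 2 := by
    have hp' : (d 1 : ℂ) = 2 * p := by exact_mod_cast hp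
    have hr' : (d 0 + d 2 + d 3 : ℂ) = 2 * r := by exact_mod_cast hr
    rw [latticeQ_gramD4, hp']
    push_cast
    linear_combination ((d 0 + d 2 + d 3 + 2 * r - 2 * p : ℂ) / 4) * hr'
  have hk : ∀ k : Fin 4 → ZMod 2, InRadical k →
      (-(k 0 * k 2 + k 0 * k 3 + k 2 * k 3) = 0 ↔ k = 0) := by decide
  have h2 : (2 : ZMod 2) = 0 := rfl
  have hc : ((2 * (p ^ 2 - p * r + r ^ 2) - (d 0 * d 2 + d 0 * d 3 + d 2 * d 3) : ℤ) : ZMod 2) =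
      -(residue d 0 * residue d 2 + residue d 0 * residue d 3 + residue d 2 * residue d 3) := by
    simp only [residue]
    push_cast
    rw [h2]
    ring
  rw [hQ, fourierE_intCast_div_two, hc, shiftSign]
  simp only [hk _ hd]

theorem thetaClass_half_vadd {k : Fin 4 → ZMod 2} (hk : InRadical k) (τ : UpperHalfPlane) :
    thetaClass k ((1 / 2 : ℝ) +ᵥ τ) 0 = shiftSign k * thetaClass k τ 0 := by
  rw [thetaClass, thetaClass, ← tsum_mul_left]
  refine tsum_congr fun d => ?_
  simp only [classGaussian]
  split_ifs with h
  · rw [← h, ← fourierE_latticeQ_div_four (h ▸ hk), gaussian, gaussian, ← fourierE_add]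
    congr 1
    rw [UpperHalfPlane.coe_vadd]
    push_cast
    ring
  · rw [mul_zero]

/-! ### Linear independence -/

/-- The classes of `2α` in `L / 2L`, for `α` among the representatives `alphaD4`. -/
def alphaClass : Fin 3 → Fin 4 → ZMod 2 := ![![0, 0, 1, 1], ![1, 0, 0, 1], ![1, 0, 1, 0]]

/-- The classes of `2β` in `L / 2L`, for `β` among the representatives `betaD4`. -/
def betaClass : Fin 3 → Fin 4 → ZMod 2 := ![![1, 1, 1, 1], ![1, 0, 0, 0], ![0, 1, 0, 0]]

theorem inRadical_zero : InRadical 0 := by decide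

theorem inRadical_alphaClass : ∀ i, InRadical (alphaClass i) := by decide

theorem thetaSeries_alphaD4_sq (i : Fin 3) (τ : UpperHalfPlane) (z : Fin 4 → ℂ) :
    thetaSeries gramD4 (alphaD4 i) 0 (τ, z) ^ 2 =
      ∑ k, thetaClass (k + alphaClass i) τ 0 * thetaClass k τ z := by
  set a : Fin 4 → ℤ := (![![0, 0, 1, 1], ![1, 0, 0, 1], ![1, 0, 1, 0]] : Fin 3 → _) i with ha
  have hres : residue a = alphaClass i := by
    funext j
    fin_cases i <;> fin_cases j <;> simp [ha, residue, alphaClass]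
  have hα (j : Fin 4) : alphaD4 i j = a j / 2 := by
    fin_cases i <;> fin_cases j <;> simp [ha, alphaD4]
  rw [thetaSeries_sq_of_inRadical (hres ▸ inRadical_alphaClass i) 0 hα (by simp), hres]
  simp only [residue_zero, signChar_zero, one_mul]

theorem thetaSeries_betaD4_sq (i : Fin 3) (τ : UpperHalfPlane) (z : Fin 4 → ℂ) :
    thetaSeries gramD4 0 (betaD4 i) (τ, z) ^ 2 =
      ∑ k, signChar (betaClass i) k * thetaClass k τ 0 * thetaClass k τ z := by
  set b : Fin 4 → ℤ := (![![1, 1, 1, 1], ![1, 0, 0, 0], ![0, 1, 0, 0]] : Fin 3 → _) i with hb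
  have hres : residue b = betaClass i := by
    funext j
    fin_cases i <;> fin_cases j <;> simp [hb, residue, betaClass]
  have hβ (j : Fin 4) : betaD4 i j = b j / 2 := by
    fin_cases i <;> fin_cases j <;> simp [hb, betaD4]
  rw [thetaSeries_sq_of_inRadical (a := 0) (residue_zero ▸ inRadical_zero) b (by simp) hβ, hres]
  simp only [residue_zero, add_zero]

theorem thetaSeries_zero_zero_sq (τ : UpperHalfPlane) (z : Fin 4 → ℂ) :
    thetaSeries gramD4 0 0 (τ, z) ^ 2 = ∑ k, thetaClass k τ 0 * thetaClass k τ z := by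
  rw [thetaSeries_sq_of_inRadical (a := 0) (residue_zero ▸ inRadical_zero) 0 (by simp) (by simp)]
  simp only [residue_zero, signChar_zero, add_zero, one_mul]

/-- The coefficient of `Θ_k(τ, z)` in a vanishing linear combination of the seven squares is
zero if `Θ_k(τ, 0) ≠ 0`. -/
theorem coeff_eq_zero_of_sum_smul_eq_zero {g : Unit ⊕ Fin 3 ⊕ Fin 3 → ℂ}
    (hg : ∑ i, g i • sevenThetaSquares i = 0) {τ : UpperHalfPlane} {k : Fin 4 → ZMod 2}
    (hk : thetaClass k τ 0 ≠ 0) :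
    (g (.inl ()) + ∑ j, g (.inr (.inr j)) * signChar (betaClass j) k) * thetaClass k τ 0 +
      ∑ i, g (.inr (.inl i)) * thetaClass (k + alphaClass i) τ 0 = 0 := by
  refine (mul_eq_zero.1 (coeff_mul_thetaClass_eq_zero (τ := τ) (g := fun k =>
    (g (.inl ()) + ∑ j, g (.inr (.inr j)) * signChar (betaClass j) k) * thetaClass k τ 0 +
      ∑ i, g (.inr (.inl i)) * thetaClass (k + alphaClass i) τ 0) (fun z => ?_) k)).resolve_right hk
  have h := congrFun hg (τ, z)
  simp only [Finset.sum_apply, Pi.smul_apply, smul_eq_mul, Fintype.sum_sum_type, sevenThetaSquares,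
    Pi.pow_apply, Pi.zero_apply, thetaSeries_zero_zero_sq, thetaSeries_alphaD4_sq,
    thetaSeries_betaD4_sq, Finset.univ_unique, Finset.sum_singleton, Fin.sum_univ_three,
    Finset.mul_sum, ← Finset.sum_add_distrib] at h
  rw [← h]
  refine Finset.sum_congr rfl fun l _ => ?_
  simp only [Fin.sum_univ_three]
  ring

theorem linearIndependent_sevenThetaSquares : LinearIndependent ℂ sevenThetaSquares := by
  rw [Fintype.linearIndependent_iff]
  intro g hg
  -- Classes in the radical, at `τ = i` and `τ = i + 1/2`.
  have hrad (k : Fin 4 → ZMod 2) (hk : InRadical k) :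
      (g (.inl ()) + ∑ j, g (.inr (.inr j))) * thetaClass k UpperHalfPlane.I 0 +
        ∑ i, g (.inr (.inl i)) * thetaClass (k + alphaClass i) UpperHalfPlane.I 0 = 0 ∧
      (g (.inl ()) + ∑ j, g (.inr (.inr j))) * (shiftSign k * thetaClass k UpperHalfPlane.I 0) +
        ∑ i, g (.inr (.inl i)) * (shiftSign (k + alphaClass i) *
          thetaClass (k + alphaClass i) UpperHalfPlane.I 0) = 0 := by
    have hs : shiftSign k ≠ 0 := by
      rw [shiftSign]
      split_ifs <;> norm_num
    have h1 := coeff_eq_zero_of_sum_smul_eq_zero hg (thetaClass_I_zero_ne_zero k)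
    have h2 := coeff_eq_zero_of_sum_smul_eq_zero hg
      (τ := (1 / 2 : ℝ) +ᵥ UpperHalfPlane.I) (k := k) (by
        rw [thetaClass_half_vadd hk]
        exact mul_ne_zero hs (thetaClass_I_zero_ne_zero k))
    have hk' (i : Fin 3) : InRadical (k + alphaClass i) :=
      ((inRadical_alphaClass i).add_iff k).2 hk
    simp only [signChar_of_inRadical _ hk, mul_one, thetaClass_half_vadd hk,
      thetaClass_half_vadd (hk' _)] at h1 h2
    exact ⟨h1, h2⟩
  have hne := thetaClass_I_zero_ne_zero 0
  have hsign : ∀ i l, alphaClass i + alphaClass l = 0 ↔ i = l := by decide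
  have hsign0 : ∀ l, alphaClass l ≠ 0 := by decide
  -- `Θ_0(τ, 0)` is even under the shift `τ ↦ τ + 1/2`, and `Θ_k(τ, 0)` is odd for the other `k`
  -- in the radical, so the two relations separate the `Θ_0(τ, 0)` term from the rest.
  have hX : g (.inl ()) + ∑ j, g (.inr (.inr j)) = 0 := by
    obtain ⟨h1, h2⟩ := hrad 0 inRadical_zero
    simp only [shiftSign, zero_add, if_neg (hsign0 _), if_pos, Fin.sum_univ_three] at h1 h2 ⊢
    refine (mul_eq_zero.1 ?_).resolve_right hne
    linear_combination (h1 + h2) / 2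
  have ha (i : Fin 3) : g (.inr (.inl i)) = 0 := by
    obtain ⟨h1, h2⟩ := hrad _ (inRadical_alphaClass i)
    simp only [hX, zero_mul, zero_add, shiftSign, hsign] at h1 h2
    have h3 : ∑ l, (if i = l then
        2 * g (.inr (.inl l)) * thetaClass (alphaClass i + alphaClass l) UpperHalfPlane.I 0
        else 0) = 0 := by
      have h := congrArg₂ (· + ·) h1 h2
      simp only [← Finset.sum_add_distrib, add_zero] at h
      refine (Finset.sum_congr rfl fun l _ => ?_).trans h
      split_ifs <;> ring
    rw [Finset.sum_ite_eq, if_pos (Finset.mem_univ _), (hsign i i).2 rfl] at h3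
    simpa [hne] using h3
  -- What remains is a relation between four distinct characters of `L / 2L♯ = (ℤ/2)²`.
  have hb (k : Fin 4 → ZMod 2) :
      g (.inl ()) + ∑ j, g (.inr (.inr j)) * signChar (betaClass j) k = 0 := by
    have h := coeff_eq_zero_of_sum_smul_eq_zero hg (thetaClass_I_zero_ne_zero k)
    simpa [ha, thetaClass_I_zero_ne_zero k] using h
  have hc (j : Fin 3) (k : Fin 4 → ZMod 2) (s : Bool)
      (h : decide (latticeB gramD4 (betaClass j) k = 0) = s) :
      signChar (betaClass j) k = if s then 1 else -1 := by
    simp [signChar, ← h]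
  have h1 := hb ![0, 1, 0, 0]
  have h2 := hb ![1, 0, 0, 0]
  have h3 := hb ![1, 1, 0, 0]
  rw [Fin.sum_univ_three] at h1 h2 h3 hX
  rw [hc 0 _ false (by decide), hc 1 _ false (by decide), hc 2 _ true (by decide)] at h1
  rw [hc 0 _ false (by decide), hc 1 _ true (by decide), hc 2 _ false (by decide)] at h2
  rw [hc 0 _ true (by decide), hc 1 _ false (by decide), hc 2 _ false (by decide)] at h3
  simp only [if_true, Bool.false_eq_true, if_false] at h1 h2 h3
  rintro (_ | i | j)
  · linear_combination (h1 + h2 + h3 + hX) / 4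
  · exact ha i
  · fin_cases j
    · change g (.inr (.inr 0)) = 0
      linear_combination (hX + h3 - h1 - h2) / 4
    · change g (.inr (.inr 1)) = 0
      linear_combination (hX + h2 - h1 - h3) / 4
    · change g (.inr (.inr 2)) = 0
      linear_combination (hX + h1 - h2 - h3) / 4

theorem mainTheorem10 :
    (∀ α ∈ dualLattice gramD4, ∀ β ∈ halfIntegral 4,
      ∀ (τ : UpperHalfPlane) (z : Fin 4 → ℂ), Summable (thetaTerm gramD4 α β τ z)) ∧
    LinearIndependent ℂ sevenThetaSquares ∧
    ∀ α ∈ dualLattice gramD4, ∀ β ∈ halfIntegral 4,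
      thetaSeries gramD4 α β ^ 2 + thetaSeries gramD4 0 0 ^ 2 =
        thetaSeries gramD4 α 0 ^ 2 + thetaSeries gramD4 0 β ^ 2 := by
  refine ⟨fun α _ β _ τ z => (summable_norm_thetaTerm_gramD4 α β τ z).of_norm,
    linearIndependent_sevenThetaSquares, fun α hα β hβ => ?_⟩
  obtain ⟨a, ha, hα⟩ := exists_eq_half_of_mem_dualLattice hα
  obtain ⟨b, hβ⟩ := hβ
  exact thetaSeries_sq_add_thetaSeries_sq ha b hα hβ
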